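/- Let $M$ be a smooth ($C^\infty$, Hausdorff, paracompact, without boundary) manifold of dimension $n$, and let $E\to M$ be a smooth real vector bundle of rank $2m+1$ carrying a Lie algebroid structure: a smooth bundle map $\rho_E:E\to TM$ over the identity and a Lie bracket $[\cdot,\cdot]_E$ on the real vector space $\Gamma(E)$ of smooth sections such that $[s_1,fs_2]_E=f[s_1,s_2]_E+\rho_E(s_1)(f)\,s_2$ for all $s_1,s_2\in\Gamma(E)$, $f\in C^\infty(M)$. Suppose that it is an almost contact Lie algebroid, i.e. there are given a smooth section $\xi$ of $E$, a smooth section $\eta$ of $E^*$ and a smooth section $F_E$ of $E\otimes E^*$ (a bundle endomorphism of $E$) with $$F_E^2=-I_E+\eta\otimes\xi,\qquad \eta(\xi)=1.$$ Then $E$ is orientable as a vector bundle: $M$ is covered by the domains of a family of smooth local frames of $E$ over open subsets of $M$, any two of which are related, at every point of the intersection of their domains, by a transition matrix of positive determinant. -/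

import Mathlib

open Bundle Module
open scoped Manifold ContDiff

noncomputable section AlgebroidDefs

variable {n : ℕ} {M : Type*} [TopologicalSpace M] [ChartedSpace (EuclideanSpace ℝ (Fin n)) M]
  (F : Type*) [NormedAddCommGroup F] [NormedSpace ℝ F]
  (V : M → Type*) [TopologicalSpace (TotalSpace F V)] [∀ x, TopologicalSpace (V x)]
  [FiberBundle F V] [∀ x, AddCommGroup (V x)] [∀ x, Module ℝ (V x)] [VectorBundle ℝ F V]

variable {F V} in
/-- The product `f s` of a smooth function `f` and a smooth section `s`. -/
def funSmulSection (f : C^∞⟮𝓡 n, M; ℝ⟯) (s : Cₛ^∞⟮𝓡 n; F, V⟯) : Cₛ^∞⟮𝓡 n; F, V⟯ :=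
  ⟨fun x ↦ f x • s x, f.contMDiff.smul_section s.contMDiff⟩

/-- The derivative `v(f)` of a smooth function `f` along a tangent vector `v` at `x`. -/
def dirDeriv (f : C^∞⟮𝓡 n, M; ℝ⟯) (x : M) (v : TangentSpace (𝓡 n) x) : ℝ :=
  mfderiv (𝓡 n) 𝓘(ℝ, ℝ) f x v

/-- A Lie algebroid structure on the smooth real vector bundle `V → M` with model fiber `F`:
a smooth bundle map `anchor : V → TM` over the identity, and a Lie bracket on the space of global
smooth sections, satisfying the Leibniz rule. -/
structure LieAlgebroid [IsManifold (𝓡 n) ∞ M] [ContMDiffVectorBundle ∞ F V (𝓡 n)] where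
  /-- The anchor `ρ : V → TM`, as a smooth section of `Hom(V, TM)`. -/
  anchor : Cₛ^∞⟮𝓡 n; F →L[ℝ] EuclideanSpace ℝ (Fin n),
    fun x : M ↦ V x →L[ℝ] TangentSpace (𝓡 n) x⟯
  /-- The bracket of sections, bilinear over `ℝ`. -/
  bracket : Cₛ^∞⟮𝓡 n; F, V⟯ →ₗ[ℝ] Cₛ^∞⟮𝓡 n; F, V⟯ →ₗ[ℝ] Cₛ^∞⟮𝓡 n; F, V⟯
  bracket_self : ∀ s, bracket s s = 0
  jacobi : ∀ s₁ s₂ s₃, bracket s₁ (bracket s₂ s₃) + bracket s₂ (bracket s₃ s₁) +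
    bracket s₃ (bracket s₁ s₂) = 0
  /-- `[s₁, f s₂] = f [s₁, s₂] + ρ(s₁)(f) s₂`. -/
  leibniz : ∀ (s₁ s₂ : Cₛ^∞⟮𝓡 n; F, V⟯) (f : C^∞⟮𝓡 n, M; ℝ⟯) (x : M),
    bracket s₁ (funSmulSection f s₂) x =
      f x • bracket s₁ s₂ x +
        dirDeriv f x (anchor x (s₁ x)) • s₂ x

/-- An almost contact Lie algebroid: a Lie algebroid together with a smooth `(1,1)`-tensor `φ`,
a smooth section `ξ` and a smooth `1`-form `η` with `φ² = -id + η ⊗ ξ` and `η(ξ) = 1`. -/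
structure AlmostContactLieAlgebroid [IsManifold (𝓡 n) ∞ M] [ContMDiffVectorBundle ∞ F V (𝓡 n)]
    [∀ x, IsTopologicalAddGroup (V x)] [∀ x, ContinuousSMul ℝ (V x)]
    extends LieAlgebroid (n := n) F V where
  φ : Cₛ^∞⟮𝓡 n; F →L[ℝ] F, fun x : M ↦ V x →L[ℝ] V x⟯
  ξ : Cₛ^∞⟮𝓡 n; F, V⟯
  η : Cₛ^∞⟮𝓡 n; F →L[ℝ] ℝ, fun x : M ↦ V x →L[ℝ] ℝ⟯
  φ_sq : ∀ (x : M) (v : V x), φ x (φ x v) = -v + η x v • ξ x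
  η_ξ : ∀ x : M, η x (ξ x) = 1

/-- A smooth local frame of `V → M` over an open set. -/
structure OpenLocalFrame where
  source : Set M
  isOpen_source : IsOpen source
  /-- the sections of the frame (only their values on `source` matter) -/
  sec : Fin (finrank ℝ F) → (x : M) → V x
  isLocalFrameOn : IsLocalFrameOn (𝓡 n) F ∞ sec source

variable {F V} in
/-- The transition matrix at `x` between two local frames: its columns are the coordinates of the
vectors of `t` in the basis given by `s`. -/
def OpenLocalFrame.transition (s t : OpenLocalFrame (n := n) F V) {x : M}
    (hs : x ∈ s.source) (ht : x ∈ t.source) :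
    Matrix (Fin (finrank ℝ F)) (Fin (finrank ℝ F)) ℝ :=
  (s.isLocalFrameOn.toBasisAt hs).toMatrix (t.isLocalFrameOn.toBasisAt ht)

/-- The vector bundle `V → M` of finite rank is orientable: `M` is covered by the domains of a
family of smooth local frames whose transition matrices all have positive determinant. -/
def IsOrientableBundle [FiniteDimensional ℝ F] : Prop :=
  ∃ 𝒜 : Set (OpenLocalFrame (n := n) F V),
    (∀ x : M, ∃ s ∈ 𝒜, x ∈ s.source) ∧
    ∀ s ∈ 𝒜, ∀ t ∈ 𝒜, ∀ (x : M) (hs : x ∈ s.source) (ht : x ∈ t.source),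
      0 < (s.transition t hs ht).det

end AlgebroidDefs

/-! Orient each fiber by its bases (v₁, …, vₖ, φ v₁, …, φ vₖ, ξ) with all vⱼ in ker η. The map
carrying one such basis to another preserves φ, ξ and η. Extended by the identity to V ⊕ ℝ, it
commutes with a complex structure, so its real determinant is |det_ℂ|² ≥ 0, and it is nonzero since
bases go to bases (`det_toMatrix_pos`). Smooth frames of this kind exist locally: extend an adapted
basis of one fiber, project the vⱼ to ker η, apply φ, and use that linear independence is an open
condition. -/

/-- A real endomorphism commuting with a linear complex structure has nonnegative determinant. -/
theorem LinearMap.det_nonneg_of_commute_complexStructure {W : Type*} [AddCommGroup W] [Module ℝ W]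
    [FiniteDimensional ℝ W] (J : Module.End ℝ W) (hJ : J * J = -1) (g : Module.End ℝ W)
    (hg : ∀ w, g (J w) = J (g w)) : 0 ≤ g.det := by
  let i : ℂ →+* Module.End ℝ W := (Complex.liftAux J hJ).toRingHom
  let : Module ℂ W := Module.compHom W i
  have hsmul : ∀ (z : ℂ) (w : W), z • w = z.re • w + z.im • J w := fun z w ↦ by
    change Complex.liftAux J hJ z w = _
    simp [Complex.liftAux_apply, Module.algebraMap_end_apply]
  have : IsScalarTower ℝ ℂ W := ⟨fun r z w ↦ by simp [hsmul, mul_smul]⟩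
  let gc : W →ₗ[ℂ] W := { g with map_smul' := fun z w ↦ by simp [hsmul, hg] }
  have h : gc.restrictScalars ℝ = g := rfl
  -- The real determinant is the norm of the complex one, its squared modulus.
  rw [← h, LinearMap.det_restrictScalars, Algebra.norm_complex_apply]
  exact Complex.normSq_nonneg _

/-- A finite-dimensional real vector space with a linear complex structure `J` has a basis of the
form `(vⱼ, J vⱼ)ⱼ`. -/
theorem exists_basis_of_complexStructure {W : Type*} [AddCommGroup W] [Module ℝ W]
    [FiniteDimensional ℝ W] (J : Module.End ℝ W) (hJ : J * J = -1) :
    ∃ (k : ℕ) (b : Basis (Fin 2 × Fin k) ℝ W), ∀ j, b (1, j) = J (b (0, j)) := by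
  let i : ℂ →+* Module.End ℝ W := (Complex.liftAux J hJ).toRingHom
  let : Module ℂ W := Module.compHom W i
  have hsmul : ∀ (z : ℂ) (w : W), z • w = z.re • w + z.im • J w := fun z w ↦ by
    change Complex.liftAux J hJ z w = _
    simp [Complex.liftAux_apply, Module.algebraMap_end_apply]
  have : IsScalarTower ℝ ℂ W := ⟨fun r z w ↦ by simp [hsmul, mul_smul]⟩
  have : FiniteDimensional ℂ W := FiniteDimensional.right ℝ ℂ W
  refine ⟨_, Complex.basisOneI.smulTower (finBasis ℂ W), fun j ↦ ?_⟩
  simp [Basis.smulTower_apply, hsmul]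

/-! ### Linear algebra in one fiber -/

section AlmostContactVectorSpace

variable {V : Type*} [AddCommGroup V] [Module ℝ V]

/-- An almost contact structure on a real vector space. -/
structure IsAlmostContact (φ : Module.End ℝ V) (ξ : V) (η : V →ₗ[ℝ] ℝ) : Prop where
  sq_apply : ∀ v, φ (φ v) = -v + η v • ξ
  apply_self : η ξ = 1

/-- Families `(v₁, …, vₖ, φ v₁, …, φ vₖ, ξ)` with all `vⱼ` in the kernel of `η`. -/
structure IsAdaptedFamily (φ : Module.End ℝ V) (ξ : V) (η : V →ₗ[ℝ] ℝ) {κ : Type*}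
    (b : Option (Fin 2 × κ) → V) : Prop where
  none_eq : b none = ξ
  ker : ∀ j, η (b (some (0, j))) = 0
  one_eq : ∀ j, b (some (1, j)) = φ (b (some (0, j)))

namespace IsAlmostContact

variable {φ : Module.End ℝ V} {ξ : V} {η : V →ₗ[ℝ] ℝ} (h : IsAlmostContact φ ξ η)
include h

/-- Since φ²ξ = 0, the identity at φ ξ reads φ ξ = η(φ ξ) ξ. Applying φ gives η(φ ξ) φ ξ = 0, and
either factor vanishing forces φ ξ = 0. -/
theorem endo_reeb : φ ξ = 0 := by
  have h2 : φ (φ ξ) = 0 := by simp [h.sq_apply, h.apply_self]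
  have h3 := h.sq_apply (φ ξ)
  rw [h2, map_zero, eq_comm, neg_add_eq_zero] at h3
  have h4 : η (φ ξ) • φ ξ = 0 := by rw [← map_smul, ← h3, h2]
  rcases smul_eq_zero.1 h4 with h5 | h5
  · rw [h3, h5, zero_smul]
  · exact h5

/-- Computing φ³v in two ways leaves η(φ v) ξ = 0; then apply η. -/
theorem form_endo (v : V) : η (φ v) = 0 := by
  have h1 := h.sq_apply (φ v)
  rw [h.sq_apply v, map_add, map_smul, h.endo_reeb, smul_zero, add_zero, map_neg,
    left_eq_add] at h1
  simpa [h.apply_self] using congrArg η h1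

/-- An endomorphism preserving an almost contact structure has nonnegative determinant. -/
theorem det_nonneg [FiniteDimensional ℝ V] (g : Module.End ℝ V) (hφ : ∀ v, g (φ v) = φ (g v))
    (hξ : g ξ = ξ) (hη : ∀ v, η (g v) = η v) : 0 ≤ g.det := by
  -- The extra real line pairs with ξ to complete φ to a complex structure.
  let J : Module.End ℝ (V × ℝ) :=
    (φ.comp (.fst ℝ V ℝ) - (LinearMap.toSpanSingleton ℝ V ξ).comp (.snd ℝ V ℝ)).prod
      (η.comp (.fst ℝ V ℝ))
  have hJ : ∀ v t, J (v, t) = (φ v - t • ξ, η v) := fun v t ↦ by simp [J]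
  have h2 : J * J = -1 := by
    refine LinearMap.ext fun ⟨v, t⟩ ↦ ?_
    simp [hJ, h.sq_apply, h.endo_reeb, h.form_endo, h.apply_self]
  have := LinearMap.det_nonneg_of_commute_complexStructure J h2 (g.prodMap LinearMap.id)
    fun ⟨v, t⟩ ↦ by simp [hJ, hφ, hξ, hη]
  have h3 := LinearMap.det_prodMap g (LinearMap.id : Module.End ℝ ℝ)
  rw [LinearMap.det_id, mul_one] at h3
  rwa [← h3]

/-- Two bases adapted to the same almost contact structure define the same orientation. -/
theorem det_toMatrix_pos {κ : Type*} [Fintype κ] {ι : Type*} [Fintype ι] [DecidableEq ι]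
    (e : Option (Fin 2 × κ) ≃ ι) (b c : Basis ι ℝ V) (hb : IsAdaptedFamily φ ξ η (b ∘ e))
    (hc : IsAdaptedFamily φ ξ η (c ∘ e)) : 0 < (b.toMatrix c).det := by
  have : FiniteDimensional ℝ V := b.finiteDimensional_of_finite
  let g : Module.End ℝ V := b.constr ℝ c
  have hg : ∀ o, g (b (e o)) = c (e o) := fun o ↦ b.constr_basis ℝ c (e o)
  have hdet : (b.toMatrix c).det = g.det := by
    rw [← LinearMap.det_toMatrix b, b.toMatrix_eq_toMatrix_constr]
    exact congrArg (fun f ↦ (LinearMap.toMatrix b b f).det) (b.ext fun i ↦ by simp [g])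
  have hne : (b.toMatrix c).det ≠ 0 := by
    rw [← Basis.det_apply]
    exact (b.isUnit_det c).ne_zero
  have hbn : b (e none) = ξ := hb.none_eq
  have hcn : c (e none) = ξ := hc.none_eq
  have hb0 : ∀ j, η (b (e (some (0, j)))) = 0 := hb.ker
  have hc0 : ∀ j, η (c (e (some (0, j)))) = 0 := hc.ker
  have hb1 : ∀ j, b (e (some (1, j))) = φ (b (e (some (0, j)))) := hb.one_eq
  have hc1 : ∀ j, c (e (some (1, j))) = φ (c (e (some (0, j)))) := hc.one_eq
  have hg1 : ∀ j, g (φ (b (e (some (0, j))))) = φ (c (e (some (0, j)))) := fun j ↦ by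
    rw [← hb1, hg, hc1]
  have hξ : g ξ = ξ := by rw [← hbn, hg, hcn, hbn]
  have hη : η ∘ₗ g = η := by
    refine (b.reindex e.symm).ext fun o ↦ ?_
    rcases o with _ | ⟨i, j⟩
    · simp [hbn, hξ]
    · fin_cases i
      · simp [hg, hb0, hc0]
      · simp [hb1, hg1, h.form_endo]
  have hφ : g ∘ₗ φ = φ ∘ₗ g := by
    refine (b.reindex e.symm).ext fun o ↦ ?_
    rcases o with _ | ⟨i, j⟩
    · simp [hbn, h.endo_reeb, hξ]
    · fin_cases i
      · simp [hg, hg1]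
      · simp [hg, hb1, hg1, h.sq_apply, hb0, hc0]
  rw [hdet] at hne ⊢
  exact lt_of_le_of_ne (h.det_nonneg g (LinearMap.congr_fun hφ) hξ (LinearMap.congr_fun hη))
    hne.symm

/-- An almost contact vector space has an adapted basis. -/
theorem exists_adaptedFamily [FiniteDimensional ℝ V] :
    ∃ (k : ℕ) (v : Option (Fin 2 × Fin k) → V), LinearIndependent ℝ v ∧
      2 * k + 1 = finrank ℝ V ∧ IsAdaptedFamily φ ξ η v := by
  let K := LinearMap.ker η
  -- On ker η the term η ⊗ ξ vanishes, so φ restricts to a complex structure.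
  let J : Module.End ℝ K := φ.restrict fun v _ ↦ h.form_endo v
  have hJ : J * J = -1 := by
    refine LinearMap.ext fun ⟨v, hv⟩ ↦ Subtype.ext ?_
    have hv' : η v = 0 := hv
    change φ (φ v) = -v
    rw [h.sq_apply, hv', zero_smul, add_zero]
  obtain ⟨k, b, hb⟩ := exists_basis_of_complexStructure J hJ
  have hη : Function.Surjective η := fun t ↦ ⟨t • ξ, by simp [h.apply_self]⟩
  have hrank := η.finrank_range_add_finrank_ker
  rw [LinearMap.range_eq_top.2 hη, finrank_top, finrank_self] at hrank
  refine ⟨k, fun o ↦ o.casesOn' ξ (K.subtype ∘ b), ?_, ?_, rfl, fun j ↦ (b (0, j)).2, fun j ↦ ?_⟩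
  · refine linearIndependent_option'.2 ⟨b.linearIndependent.map' K.subtype K.ker_subtype, ?_⟩
    intro hmem
    have hle : Submodule.span ℝ (Set.range fun p ↦ (b p : V)) ≤ K :=
      Submodule.span_le.2 (Set.range_subset_iff.2 fun p ↦ (b p).2)
    have : η ξ = 0 := hle hmem
    rw [h.apply_self] at this
    exact one_ne_zero this
  · rw [← hrank, finrank_eq_card_basis b, Fintype.card_prod, Fintype.card_fin, Fintype.card_fin,
      add_comm]
  · exact congrArg Subtype.val (hb j)

end IsAlmostContact

end AlmostContactVectorSpace

/-! ### From independence at a point to local frames -/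

section VectorBundleFrames

variable {n : ℕ} {M : Type*} [TopologicalSpace M] [ChartedSpace (EuclideanSpace ℝ (Fin n)) M]
  {F : Type*} [NormedAddCommGroup F] [NormedSpace ℝ F]
  {V : M → Type*} [TopologicalSpace (TotalSpace F V)] [∀ x, TopologicalSpace (V x)]
  [FiberBundle F V] [∀ x, AddCommGroup (V x)] [∀ x, Module ℝ (V x)] [VectorBundle ℝ F V]

variable (F) in
/-- The trivialization of a vector bundle at `x` as a linear equivalence `V x ≃ F`. -/
noncomputable def fiberLinearEquiv (x : M) : V x ≃ₗ[ℝ] F :=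
  (trivializationAt F V x).linearEquivAt ℝ x (FiberBundle.mem_baseSet_trivializationAt' x)

open Topology Filter

/-- Continuous sections which are linearly independent at a point are so in a neighbourhood. -/
theorem eventually_linearIndependent_sections [FiniteDimensional ℝ F] {ι : Type*} [Finite ι]
    {s : ι → (x : M) → V x} {x₀ : M}
    (hs : ∀ i, ContinuousAt (fun x ↦ TotalSpace.mk' F x (s i x)) x₀)
    (hli : LinearIndependent ℝ (s · x₀)) : ∀ᶠ x in 𝓝 x₀, LinearIndependent ℝ (s · x) := by
  let t := trivializationAt F V x₀
  have key : ∀ x, x ∈ t.baseSet →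
      (LinearIndependent ℝ (fun i ↦ (t ⟨x, s i x⟩).2) ↔ LinearIndependent ℝ (s · x)) :=
    fun x hx ↦ (t.linearEquivAt ℝ x hx).toLinearMap.linearIndependent_iff
      (LinearEquiv.ker (t.linearEquivAt ℝ x hx))
  have hx₀ : x₀ ∈ t.baseSet := FiberBundle.mem_baseSet_trivializationAt' x₀
  have hc : ContinuousAt (fun x i ↦ (t ⟨x, s i x⟩).2) x₀ :=
    continuousAt_pi.2 fun i ↦ ((FiberBundle.continuousAt_totalSpace F _).1 (hs i)).2
  filter_upwards [hc.eventually ((key x₀ hx₀).2 hli).eventually, t.open_baseSet.mem_nhds hx₀]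
    with x h1 h2 using (key x h2).1 h1

/-- Smooth sections forming a basis at a point form a smooth frame over an open neighbourhood. -/
theorem exists_isOpen_isLocalFrameOn [FiniteDimensional ℝ F] {ι : Type*} [Fintype ι]
    (hcard : Fintype.card ι = finrank ℝ F) {s : ι → (x : M) → V x} {x₀ : M}
    {U : Set M} (hU : U ∈ 𝓝 x₀)
    (hs : ∀ i, ContMDiffOn (𝓡 n) ((𝓡 n).prod 𝓘(ℝ, F)) ∞ (fun x ↦ TotalSpace.mk' F x (s i x)) U)
    (hli : LinearIndependent ℝ (s · x₀)) :
    ∃ U', IsOpen U' ∧ x₀ ∈ U' ∧ IsLocalFrameOn (𝓡 n) F ∞ s U' := by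
  have hev := eventually_linearIndependent_sections
    (fun i ↦ ((hs i).contMDiffAt hU).continuousAt) hli
  obtain ⟨U', hsub, hopen, hmem⟩ := mem_nhds_iff.1 (inter_mem hev hU)
  refine ⟨U', hopen, hmem, fun hx ↦ (hsub hx).1, fun {x} hx ↦ ?_,
    fun i ↦ (hs i).mono fun x hx ↦ (hsub hx).2⟩
  have : FiniteDimensional ℝ (V x) := (fiberLinearEquiv F x).symm.finiteDimensional
  exact (LinearIndependent.span_eq_top_of_card_eq_finrank' (hsub hx).1
    (hcard.trans (fiberLinearEquiv F x).finrank_eq.symm)).ge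

end VectorBundleFrames

/-! ### Adapted local sections -/

namespace AlmostContactLieAlgebroid

open Topology

variable {n : ℕ} {M : Type*} [TopologicalSpace M] [ChartedSpace (EuclideanSpace ℝ (Fin n)) M]
  [IsManifold (𝓡 n) ∞ M] {F : Type*} [NormedAddCommGroup F] [NormedSpace ℝ F]
  {V : M → Type*} [TopologicalSpace (TotalSpace F V)] [∀ x, TopologicalSpace (V x)]
  [FiberBundle F V] [∀ x, AddCommGroup (V x)] [∀ x, Module ℝ (V x)] [VectorBundle ℝ F V]
  [∀ x, IsTopologicalAddGroup (V x)] [∀ x, ContinuousSMul ℝ (V x)]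
  [ContMDiffVectorBundle ∞ F V (𝓡 n)] (A : AlmostContactLieAlgebroid (n := n) F V)

theorem isAlmostContact (x : M) :
    IsAlmostContact (A.φ x : V x →ₗ[ℝ] V x) (A.ξ x) (A.η x : V x →ₗ[ℝ] ℝ) :=
  ⟨A.φ_sq x, A.η_ξ x⟩

/-- The projection of the section `s` to the kernel of `η` along `ξ`. -/
noncomputable def kerProj (s : (x : M) → V x) (x : M) : V x := s x - A.η x (s x) • A.ξ x

theorem η_kerProj (s : (x : M) → V x) (x : M) : A.η x (A.kerProj s x) = 0 := by
  simp [kerProj, A.η_ξ]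

theorem contMDiffOn_kerProj {s : (x : M) → V x} {U : Set M}
    (hs : ContMDiffOn (𝓡 n) ((𝓡 n).prod 𝓘(ℝ, F)) ∞ (fun x ↦ TotalSpace.mk' F x (s x)) U) :
    ContMDiffOn (𝓡 n) ((𝓡 n).prod 𝓘(ℝ, F)) ∞
      (fun x ↦ TotalSpace.mk' F x (A.kerProj s x)) U := by
  have h1 : ContMDiffOn (𝓡 n) ((𝓡 n).prod 𝓘(ℝ, ℝ)) ∞
      (fun x ↦ TotalSpace.mk' ℝ (E := fun _ : M ↦ ℝ) x (A.η x (s x))) U :=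
    A.η.contMDiff.contMDiffOn.clm_bundle_apply hs
  have h2 : ContMDiffOn (𝓡 n) 𝓘(ℝ, ℝ) ∞ (fun x ↦ A.η x (s x)) U := fun x hx ↦ by
    simpa using Bundle.contMDiffWithinAt_section.1 (h1 x hx)
  exact hs.sub_section (h2.smul_section A.ξ.contMDiff.contMDiffOn)

/-- Extension of an adapted basis of a fiber to sections forming an adapted family. -/
noncomputable def adaptedExtend {κ : Type*} {x₀ : M} (v : Option (Fin 2 × κ) → V x₀) :
    Option (Fin 2 × κ) → (x : M) → V x
  | none => A.ξ
  | some (0, j) => A.kerProj (FiberBundle.extend F (v (some (0, j))))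
  | some (1, j) => fun x ↦ A.φ x (A.kerProj (FiberBundle.extend F (v (some (0, j)))) x)

/-- Projection and φ act fiberwise, so this holds on all of M, even where the extension is not
smooth. -/
theorem isAdaptedFamily_adaptedExtend {κ : Type*} {x₀ : M} (v : Option (Fin 2 × κ) → V x₀)
    (x : M) : IsAdaptedFamily (A.φ x : V x →ₗ[ℝ] V x) (A.ξ x) (A.η x : V x →ₗ[ℝ] ℝ)
      (A.adaptedExtend v · x) :=
  ⟨rfl, fun _ ↦ A.η_kerProj _ x, fun _ ↦ rfl⟩

theorem adaptedExtend_self {κ : Type*} {x₀ : M} {v : Option (Fin 2 × κ) → V x₀}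
    (hv : IsAdaptedFamily (A.φ x₀ : V x₀ →ₗ[ℝ] V x₀) (A.ξ x₀) (A.η x₀ : V x₀ →ₗ[ℝ] ℝ) v)
    (o : Option (Fin 2 × κ)) : A.adaptedExtend v o x₀ = v o := by
  have h0 : ∀ j, A.kerProj (FiberBundle.extend F (v (some (0, j)))) x₀ = v (some (0, j)) := by
    intro j
    have : A.η x₀ (v (some (0, j))) = 0 := hv.ker j
    simp [kerProj, this]
  rcases o with _ | ⟨i, j⟩
  · exact hv.none_eq.symm
  · fin_cases i
    · exact h0 j
    · exact (congrArg (A.φ x₀) (h0 j)).trans (hv.one_eq j).symm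

theorem exists_contMDiffOn_adaptedExtend {κ : Type*} [Finite κ] {x₀ : M}
    (v : Option (Fin 2 × κ) → V x₀) : ∃ U ∈ 𝓝 x₀, ∀ o,
      ContMDiffOn (𝓡 n) ((𝓡 n).prod 𝓘(ℝ, F)) ∞
        (fun x ↦ TotalSpace.mk' F x (A.adaptedExtend v o x)) U := by
  choose U hU hs using fun j ↦
    FiberBundle.exists_contMDiffOn_extend (k := ∞) (𝓡 n) F (v (some (0, j)))
  refine ⟨⋂ j, U j, Filter.iInter_mem.2 hU, fun o ↦ ?_⟩
  have h0 := fun j ↦ A.contMDiffOn_kerProj ((hs j).mono (Set.iInter_subset U j))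
  rcases o with _ | ⟨i, j⟩
  · exact A.ξ.contMDiff.contMDiffOn
  · fin_cases i
    · exact h0 j
    · exact A.φ.contMDiff.contMDiffOn.clm_bundle_apply (h0 j)

end AlmostContactLieAlgebroid

theorem corollary2p1 {n : ℕ} {M : Type*} [TopologicalSpace M] [T2Space M] [ParacompactSpace M]
    [ChartedSpace (EuclideanSpace ℝ (Fin n)) M] [IsManifold (𝓡 n) ∞ M]
    {F : Type*} [NormedAddCommGroup F] [NormedSpace ℝ F] [FiniteDimensional ℝ F]
    {V : M → Type*} [TopologicalSpace (TotalSpace F V)] [∀ x, TopologicalSpace (V x)]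
    [FiberBundle F V] [∀ x, AddCommGroup (V x)] [∀ x, Module ℝ (V x)] [VectorBundle ℝ F V]
    [∀ x, IsTopologicalAddGroup (V x)] [∀ x, ContinuousSMul ℝ (V x)]
    [ContMDiffVectorBundle ∞ F V (𝓡 n)]
    (m : ℕ) (hrank : Module.finrank ℝ F = 2 * m + 1)
    (A : AlmostContactLieAlgebroid (n := n) F V) :
    IsOrientableBundle (n := n) F V := by
  -- Any numbering works, provided all frames share it.
  let e : Option (Fin 2 × Fin m) ≃ Fin (finrank ℝ F) :=
    Fintype.equivOfCardEq (by simp [hrank])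
  refine ⟨{s | ∀ x ∈ s.source, IsAdaptedFamily (A.φ x : V x →ₗ[ℝ] V x) (A.ξ x)
    (A.η x : V x →ₗ[ℝ] ℝ) (fun o ↦ s.sec (e o) x)}, fun x₀ ↦ ?_, ?_⟩
  · have : FiniteDimensional ℝ (V x₀) := (fiberLinearEquiv F x₀).symm.finiteDimensional
    obtain ⟨k, v, hli, hk, hv⟩ := (A.isAlmostContact x₀).exists_adaptedFamily
    obtain rfl : k = m := by
      rw [(fiberLinearEquiv F x₀).finrank_eq, hrank] at hk
      omega
    obtain ⟨U, hU, hs⟩ := A.exists_contMDiffOn_adaptedExtend v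
    obtain ⟨U', hopen, hmem, hframe⟩ := exists_isOpen_isLocalFrameOn (Fintype.card_fin _) hU
      (s := fun i ↦ A.adaptedExtend v (e.symm i)) (fun i ↦ hs _) (by
        simp only [A.adaptedExtend_self hv]
        exact hli.comp _ e.symm.injective)
    refine ⟨⟨U', hopen, _, hframe⟩, fun x _ ↦ ?_, hmem⟩
    simpa using A.isAdaptedFamily_adaptedExtend v x
  · intro s hs t ht x hxs hxt
    refine (A.isAlmostContact x).det_toMatrix_pos e _ _ ?_ ?_
    · simpa [Function.comp_def] using hs x hxs
    · simpa [Function.comp_def] using ht x hxt
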